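/- Let $X$ and $Y$ be compact Hausdorff spaces, with $X$ connected and $Y$ second countable, and let $p\colon Y\to X$ be a continuous surjection. Regard $C(Y)=C(Y,\mathbb C)$, with the supremum norm, as a Banach module over $C(X)=C(X,\mathbb C)$ through the action $(f\xi)(y)=f(y)\,\xi(p(y))$ for $f\in C(Y)$, $\xi\in C(X)$. Then the following are equivalent: (i) $C(Y)$ is a self-dual Hilbert $C(X)$-module with respect to this action; that is, there is a $C(X)$-valued inner product $\langle\cdot,\cdot\rangle$ on the $C(X)$-module $C(Y)$ whose norm $\|\langle f,f\rangle\|^{1/2}$ is equivalent to the supremum norm of $C(Y)$ (so that $C(Y)$ becomes a Hilbert $C(X)$-module), and such that $f\mapsto\langle f,\cdot\rangle$ is an isomorphism of $C(Y)$ onto the dual module of all bounded $C(X)$-linear maps $C(Y)\to C(X)$; (ii) $p$ is a finite-fold covering, that is, $p$ is a covering map and there is an $n\in\mathbb N$ such that every fibre $p^{-1}(x)$, $x\in X$, has exactly $n$ points. -/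

import Mathlib

open scoped ComplexOrder

/-- A Hilbert C⋆-module `M` over `A` is self-dual if the map `x ↦ ⟪x, ·⟫` from `M` to the dual
module of all bounded `A`-linear maps `M → A` is an isomorphism. This map always takes values in
the dual module and is isometric (Cauchy-Schwarz), so that the condition is its bijectivity. -/
def IsSelfDualCStarModule (A M : Type*) [CStarAlgebra A] [PartialOrder A] [AddCommGroup M]
    [Module ℂ M] [Module A M] [Norm M] [CStarModule A M] : Prop :=
  ∀ φ : M →ₗ[A] A, (∃ K : ℝ, ∀ y : M, ‖φ y‖ ≤ K * ‖y‖) →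
    ∃! x : M, ∀ y : M, φ y = inner A x y

section PullbackModule

variable {X Y : Type*} [TopologicalSpace X] [TopologicalSpace Y]

/-- The space `C(Y)` of continuous complex functions on `Y`, regarded as a module over `C(X)`
through a continuous map `p : Y → X`. It is a copy of `C(Y, ℂ)` without a norm of its own. -/
structure PullbackModule (p : C(Y, X)) where
  /-- The underlying continuous function. -/
  toContinuousMap : C(Y, ℂ)

namespace PullbackModule

variable (p : C(Y, X))

/-- The identification of the copy with `C(Y, ℂ)`. -/
def equiv : PullbackModule p ≃ C(Y, ℂ) where
  toFun := toContinuousMap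
  invFun := mk
  left_inv _ := rfl
  right_inv _ := rfl

noncomputable instance : AddCommGroup (PullbackModule p) := (equiv p).addCommGroup

noncomputable instance : Module ℂ (PullbackModule p) := (equiv p).module ℂ

/-- The action `(ξ • f) y = ξ (p y) * f y`. -/
noncomputable instance : SMul C(X, ℂ) (PullbackModule p) where
  smul ξ f := ⟨ξ.comp p * f.toContinuousMap⟩

variable {p}

@[ext]
theorem ext {f g : PullbackModule p} (h : f.toContinuousMap = g.toContinuousMap) : f = g := by
  cases f; cases g; cases h; rfl

@[simp]
theorem toContinuousMap_zero : (0 : PullbackModule p).toContinuousMap = 0 := rfl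

@[simp]
theorem toContinuousMap_add (f g : PullbackModule p) :
    (f + g).toContinuousMap = f.toContinuousMap + g.toContinuousMap := rfl

@[simp]
theorem toContinuousMap_smul_complex (z : ℂ) (f : PullbackModule p) :
    (z • f).toContinuousMap = z • f.toContinuousMap := rfl

@[simp]
theorem toContinuousMap_smul (ξ : C(X, ℂ)) (f : PullbackModule p) :
    (ξ • f).toContinuousMap = ξ.comp p * f.toContinuousMap := rfl

noncomputable instance : Module C(X, ℂ) (PullbackModule p) where
  one_smul f := by ext; simp
  mul_smul a b f := by ext; simp [mul_assoc]
  smul_zero a := by ext; simp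
  smul_add a f g := by ext; simp [mul_add]
  add_smul a b f := by ext; simp [add_mul]
  zero_smul f := by ext; simp

end PullbackModule

/-- `C(Y)` is a self-dual Hilbert `C(X)`-module with respect to the action given by `p`: the Banach
`C(X)`-module `C(Y)` carries a `C(X)`-valued inner product whose norm `‖⟪f, f⟫‖ ^ (1 / 2)` is
equivalent to the supremum norm (in particular it is complete), and the resulting Hilbert
C⋆-module is self-dual. -/
def IsSelfDualPullback [CompactSpace X] [CompactSpace Y] (p : C(Y, X)) : Prop :=
  ∃ (_ : Norm (PullbackModule p)) (_ : CStarModule C(X, ℂ) (PullbackModule p)),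
    (∃ c K : ℝ, 0 < c ∧ 0 < K ∧ ∀ f : PullbackModule p,
      c * ‖f.toContinuousMap‖ ≤ ‖f‖ ∧ ‖f‖ ≤ K * ‖f.toContinuousMap‖) ∧
    IsSelfDualCStarModule C(X, ℂ) (PullbackModule p)

/-- A finite-fold covering: a covering map all of whose fibres have the same finite number of
points. -/
def IsFiniteFoldCovering (p : Y → X) : Prop :=
  IsCoveringMap p ∧ ∃ n : ℕ, ∀ x : X, (p ⁻¹' {x}).encard = n

end PullbackModule

open Filter Topology

theorem exists_bump {Z : Type*} [TopologicalSpace Z] [CompactSpace Z] [T2Space Z] {z : Z}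
    {U : Set Z} (hU : U ∈ 𝓝 z) :
    ∃ ξ : C(Z, ℂ), ξ z = 1 ∧ (∀ w, ‖ξ w‖ ≤ 1) ∧ ∀ w ∉ U, ξ w = 0 := by
  obtain ⟨V, hVU, hV, hzV⟩ := mem_nhds_iff.mp hU
  obtain ⟨f, hf0, hf1, hf⟩ := exists_continuous_zero_one_of_isClosed hV.isClosed_compl
    (isClosed_singleton (x := z)) (by simpa using hzV)
  refine ⟨⟨fun w => (f w : ℂ), by fun_prop⟩, ?_, fun w => ?_, fun w hw => ?_⟩
  · simp [hf1 rfl]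
  · simpa [abs_of_nonneg (hf w).1] using (hf w).2
  · simp [hf0 (fun h => hw (hVU h))]

theorem exists_disjoint_bumps {Z : Type*} [TopologicalSpace Z] [CompactSpace Z] [T2Space Z]
    {F : Set Z} (hF : F.Finite) :
    ∃ e : Z → C(Z, ℂ), (∀ z ∈ F, e z z = 1) ∧ (∀ z ∈ F, ∀ w, ‖e z w‖ ≤ 1) ∧
      ∀ z ∈ F, ∀ z' ∈ F, z ≠ z' → ∀ w, e z w = 0 ∨ e z' w = 0 := by
  obtain ⟨U, hU, hd⟩ := hF.t2_separation
  choose e h1 h2 h3 using fun z => exists_bump ((hU z).2.mem_nhds (hU z).1)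
  refine ⟨e, fun z _ => h1 z, fun z _ => h2 z, fun z hz z' hz' hne w => ?_⟩
  by_cases hw : w ∈ U z
  · exact .inr (h3 z' w fun hw' => (hd hz hz' hne).le_bot ⟨hw, hw'⟩)
  · exact .inl (h3 z w hw)

namespace PullbackModule

variable {X Y : Type*} [TopologicalSpace X] [TopologicalSpace Y]
    [CompactSpace X] [T2Space X] [CompactSpace Y] {p : C(Y, X)}
    [Norm (PullbackModule p)] [CStarModule C(X, ℂ) (PullbackModule p)] {c K : ℝ}

theorem sq_mul_le_norm_inner_self (hc : 0 < c)
    (hcK : ∀ f : PullbackModule p, c * ‖f.toContinuousMap‖ ≤ ‖f‖)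
    (f : PullbackModule p) (y : Y) :
    (c * ‖f.toContinuousMap y‖) ^ 2 ≤ ‖inner C(X, ℂ) f f (p y)‖ := by
  by_contra! h
  obtain ⟨s, hs, hs'⟩ := exists_between h
  have hU : {x | ‖inner C(X, ℂ) f f x‖ < s} ∈ 𝓝 (p y) :=
    (isOpen_lt (by fun_prop) continuous_const).mem_nhds hs
  obtain ⟨ξ, h1, h2, h3⟩ := exists_bump hU
  have hs0 : 0 ≤ s := (norm_nonneg _).trans hs.le
  have hle : ‖ξ • f‖ ^ 2 ≤ s := by
    rw [CStarModule.norm_sq_eq C(X, ℂ), ContinuousMap.norm_le _ hs0]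
    intro x
    have hx : ‖inner C(X, ℂ) (ξ • f) (ξ • f) x‖ = ‖ξ x‖ * (‖inner C(X, ℂ) f f x‖ * ‖ξ x‖) := by
      simp
    rw [hx]
    by_cases hxU : ‖inner C(X, ℂ) f f x‖ < s
    · have := mul_le_of_le_one_right (norm_nonneg (inner C(X, ℂ) f f x)) (h2 x)
      exact (mul_le_of_le_one_left (by positivity) (h2 x)).trans (this.trans hxU.le)
    · simp [h3 x hxU, hs0]
  have hy : ‖f.toContinuousMap y‖ ≤ ‖(ξ • f).toContinuousMap‖ := by
    simpa [h1] using (ξ • f).toContinuousMap.norm_coe_le_norm y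
  have : (c * ‖f.toContinuousMap y‖) ^ 2 ≤ ‖ξ • f‖ ^ 2 :=
    pow_le_pow_left₀ (by positivity) ((by gcongr : _ ≤ _).trans (hcK (ξ • f))) 2
  linarith

theorem norm_inner_apply_le (hK : 0 < K)
    (hcK : ∀ f : PullbackModule p, ‖f‖ ≤ K * ‖f.toContinuousMap‖)
    (g r : PullbackModule p) {x : X} {δ : ℝ} (hδ : 0 ≤ δ)
    (hr : ∀ y, p y = x → ‖r.toContinuousMap y‖ ≤ δ) :
    ‖inner C(X, ℂ) g r x‖ ≤ ‖g‖ * (K * δ) := by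
  have key : ∀ δ' > δ, ‖inner C(X, ℂ) g r x‖ ≤ ‖g‖ * (K * δ') := by
    intro δ' hδ'
    have hU : {x | ∀ y, p y = x → ‖r.toContinuousMap y‖ < δ'} ∈ 𝓝 x := by
      refine (p.continuous.isClosedMap.eventually_nhds_fiber
        (p := fun y => ‖r.toContinuousMap y‖ < δ') x ?_).mono ?_
      · intro y hy
        exact (isOpen_lt (by fun_prop) continuous_const).mem_nhds ((hr y hy).trans_lt hδ')
      · intro x' hx' y hy
        exact (hx' y hy)
    obtain ⟨ξ, h1, h2, h3⟩ := exists_bump hU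
    have hn : ‖(ξ • r).toContinuousMap‖ ≤ δ' := by
      rw [ContinuousMap.norm_le _ (hδ.trans hδ'.le)]
      intro y
      simp only [toContinuousMap_smul, ContinuousMap.mul_apply, ContinuousMap.comp_apply, norm_mul]
      by_cases hy : ‖r.toContinuousMap y‖ < δ'
      · exact (mul_le_of_le_one_left (norm_nonneg _) (h2 _)).trans hy.le
      · rw [h3 (p y) fun h => hy (h y rfl)]
        simpa using hδ.trans hδ'.le
    calc ‖inner C(X, ℂ) g r x‖ = ‖inner C(X, ℂ) g (ξ • r) x‖ := by simp [h1]
      _ ≤ ‖inner C(X, ℂ) g (ξ • r)‖ := ContinuousMap.norm_coe_le_norm _ _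
      _ ≤ ‖g‖ * ‖ξ • r‖ := CStarModule.norm_inner_le _
      _ ≤ ‖g‖ * (K * δ') := by
        have := CStarModule.norm_nonneg C(X, ℂ) (x := g)
        gcongr
        exact (hcK _).trans (by gcongr)
  have ht : Tendsto (fun δ' => ‖g‖ * (K * δ')) (𝓝[>] δ) (𝓝 (‖g‖ * (K * δ))) :=
    (Continuous.tendsto (by fun_prop) δ).mono_left nhdsWithin_le_nhds
  exact ge_of_tendsto ht (eventually_mem_nhdsWithin.mono key)

variable [T2Space Y]

theorem isOpenMap_of_norm_le (hc : 0 < c) (hK : 0 < K)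
    (hcK : ∀ f : PullbackModule p, c * ‖f.toContinuousMap‖ ≤ ‖f‖ ∧
      ‖f‖ ≤ K * ‖f.toContinuousMap‖) : IsOpenMap p := by
  refine IsOpenMap.of_nhds_le fun y => ?_
  intro s hs
  obtain ⟨e, h1, h2, h3⟩ := exists_bump (mem_map.mp hs)
  have hpos := sq_mul_le_norm_inner_self hc (fun f => (hcK f).1) ⟨e⟩ y
  have hpos' : 0 < ‖inner C(X, ℂ) (⟨e⟩ : PullbackModule p) ⟨e⟩ (p y)‖ :=
    lt_of_lt_of_le (by simp [h1, hc]) hpos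
  have hev : ∀ᶠ x in 𝓝 (p y), 0 < ‖inner C(X, ℂ) (⟨e⟩ : PullbackModule p) ⟨e⟩ x‖ :=
    (isOpen_lt continuous_const (by fun_prop)).mem_nhds hpos'
  filter_upwards [hev] with x hx
  by_contra hxs
  refine hx.not_ge ?_
  have := norm_inner_apply_le hK (fun f => (hcK f).2) ⟨e⟩ ⟨e⟩ (x := x) le_rfl (fun y' hy' => ?_)
  · simpa using this
  · rw [norm_le_zero_iff]
    refine h3 y' fun h => hxs (by simpa [hy'] using h)

theorem finite_fiber_of_norm_le (hc : 0 < c) (hK : 0 < K)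
    (hcK : ∀ f : PullbackModule p, c * ‖f.toContinuousMap‖ ≤ ‖f‖ ∧
      ‖f‖ ≤ K * ‖f.toContinuousMap‖) (x : X) : (p ⁻¹' {x}).Finite := by
  by_contra hinf
  obtain ⟨n, hn⟩ := exists_nat_gt (K ^ 2 / c ^ 2)
  obtain ⟨s, hs, hsn⟩ := Set.Infinite.exists_subset_card_eq hinf n
  obtain ⟨e, h1, h2, h3⟩ := exists_disjoint_bumps s.finite_toSet
  have key : ∀ t ⊆ s, ∃ g : PullbackModule p, (∀ w, ‖g.toContinuousMap w‖ ≤ 1) ∧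
      (∀ w, (∀ z ∈ t, e z w = 0) → g.toContinuousMap w = 0) ∧
      t.card * c ^ 2 ≤ (inner C(X, ℂ) g g x).re := by
    classical
    intro t
    induction t using Finset.induction_on with
    | empty => exact fun _ => ⟨0, by simp, by simp, by simp⟩
    | insert a t hat ih =>
      intro hts
      obtain ⟨g, hg1, hg2, hg3⟩ := ih fun z hz => hts (Finset.mem_insert_of_mem hz)
      have has : a ∈ s := hts (Finset.mem_insert_self _ _)
      have hea : c ^ 2 ≤ (inner C(X, ℂ) (⟨e a⟩ : PullbackModule p) ⟨e a⟩ x).re := by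
        have := sq_mul_le_norm_inner_self hc (fun f => (hcK f).1) ⟨e a⟩ a
        have hpa : p a = x := hs has
        have h0 : (0 : C(X, ℂ)) ≤ inner C(X, ℂ) (⟨e a⟩ : PullbackModule p) ⟨e a⟩ :=
          CStarModule.inner_self_nonneg
        have h0x : 0 ≤ inner C(X, ℂ) (⟨e a⟩ : PullbackModule p) ⟨e a⟩ x := h0 x
        rw [hpa] at this
        rw [← Complex.re_eq_norm.mpr h0x] at this
        simpa [h1 a has] using this
      have hdisj : ∀ w, e a w = 0 ∨ g.toContinuousMap w = 0 := by
        intro w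
        by_cases hw : e a w = 0
        · exact .inl hw
        · refine .inr (hg2 w fun z hz => ?_)
          refine (h3 a has z (hts (Finset.mem_insert_of_mem hz)) ?_ w).resolve_left hw
          rintro rfl; exact hat hz
      have hsw : (inner C(X, ℂ) (⟨e a⟩ : PullbackModule p) g x).re =
          (inner C(X, ℂ) g (⟨e a⟩ : PullbackModule p) x).re := by
        rw [← CStarModule.star_inner g]; rfl
      obtain ⟨σ, hσ, hσ'⟩ : ∃ σ : ℂ, (σ = 1 ∨ σ = -1) ∧
          0 ≤ (σ * inner C(X, ℂ) g (⟨e a⟩ : PullbackModule p) x).re := by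
        rcases le_total 0 (inner C(X, ℂ) g (⟨e a⟩ : PullbackModule p) x).re with h | h
        · exact ⟨1, .inl rfl, by simpa⟩
        · exact ⟨-1, .inr rfl, by simpa⟩
      refine ⟨g + σ • ⟨e a⟩, fun w => ?_, fun w hw => ?_, ?_⟩
      · rcases hdisj w with hw | hw
        · simpa [hw] using hg1 w
        · have : ‖σ‖ = 1 := by rcases hσ with rfl | rfl <;> simp
          simpa [hw, this] using h2 a has w
      · simp [hg2 w fun z hz => hw z (Finset.mem_insert_of_mem hz),
          hw a (Finset.mem_insert_self _ _)]
      · rw [Finset.card_insert_of_notMem hat]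
        rcases hσ with rfl | rfl
        · simp at hσ' ⊢
          linarith
        · simp at hσ' ⊢
          linarith
  obtain ⟨g, hg1, -, hg3⟩ := key s subset_rfl
  have hle : (inner C(X, ℂ) g g x).re ≤ K ^ 2 := by
    calc (inner C(X, ℂ) g g x).re ≤ ‖inner C(X, ℂ) g g x‖ := Complex.re_le_norm _
      _ ≤ ‖inner C(X, ℂ) g g‖ := ContinuousMap.norm_coe_le_norm _ _
      _ = ‖g‖ ^ 2 := (CStarModule.norm_sq_eq C(X, ℂ)).symm
      _ ≤ K ^ 2 := by
        refine pow_le_pow_left₀ (CStarModule.norm_nonneg C(X, ℂ)) ((hcK g).2.trans ?_) 2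
        exact mul_le_of_le_one_right hK.le ((ContinuousMap.norm_le _ zero_le_one).mpr hg1)
  rw [div_lt_iff₀ (by positivity), ← hsn] at hn
  linarith

end PullbackModule

theorem continuous_apply_of_tendsto_norm {X : Type*} [TopologicalSpace X] [CompactSpace X]
    {a : ℕ → C(X, ℂ)} {κ : X → ℕ} (hκ : ∀ k x, a k x ≠ 0 → κ x = k)
    (ha : Tendsto (fun k => ‖a k‖) atTop (𝓝 0)) : Continuous fun x => a (κ x) x := by
  have hS : ∀ n x, (∑ k ∈ Finset.range n, a k) x = if κ x < n then a (κ x) x else 0 := by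
    intro n x
    rw [ContinuousMap.sum_apply]
    split_ifs with h
    · refine Finset.sum_eq_single_of_mem _ (Finset.mem_range.mpr h) fun k _ hk => ?_
      by_contra h0
      exact hk (hκ k x h0).symm
    · refine Finset.sum_eq_zero fun k hk => ?_
      by_contra h0
      exact h (hκ k x h0 ▸ Finset.mem_range.mp hk)
  refine TendstoUniformly.continuous (F := fun n x => (∑ k ∈ Finset.range n, a k) x) (p := atTop)
    ?_ (Frequently.of_forall fun n => (∑ k ∈ Finset.range n, a k).continuous)
  rw [Metric.tendstoUniformly_iff]
  intro ε hε
  obtain ⟨n, hn⟩ := eventually_atTop.mp (ha.eventually_lt_const hε)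
  refine eventually_atTop.mpr ⟨n, fun m hm x => ?_⟩
  rw [hS]
  split_ifs with h
  · simpa
  · rw [dist_zero_right]
    exact ((a _).norm_coe_le_norm x).trans_lt (hn _ (hm.trans (not_lt.mp h)))

section SelfDual

variable {X : Type*} [TopologicalSpace X] [CompactSpace X]
  {M : Type*} [AddCommGroup M] [Module ℂ M] [Module C(X, ℂ) M] [Norm M] [CStarModule C(X, ℂ) M]

theorem exists_linearMap_of_disjoint {h : ℕ → C(X, ℂ)} {g : ℕ → M} {B : ℝ}
    (hdisj : ∀ i j, i ≠ j → ∀ x, h i x = 0 ∨ h j x = 0) (h1 : ∀ k x, ‖h k x‖ ≤ 1)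
    (hB : ∀ k, ‖g k‖ ≤ B)
    (ht : ∀ f, Tendsto (fun k => ‖h k * inner C(X, ℂ) (g k) f‖) atTop (𝓝 0)) :
    ∃ φ : M →ₗ[C(X, ℂ)] C(X, ℂ), (∃ K : ℝ, ∀ f, ‖φ f‖ ≤ K * ‖f‖) ∧
      ∀ f k x, h k x ≠ 0 → φ f x = h k x * inner C(X, ℂ) (g k) f x := by
  obtain ⟨κ, hκ⟩ : ∃ κ : X → ℕ, ∀ x k, h k x ≠ 0 → κ x = k := by
    refine Classical.axiom_of_choice (r := fun x k' => ∀ k, h k x ≠ 0 → k' = k) fun x => ?_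
    by_cases hx : ∃ k, h k x ≠ 0
    · obtain ⟨k, hk⟩ := hx
      refine ⟨k, fun j hj => ?_⟩
      by_contra hne
      exact (hdisj k j hne x).elim hk hj
    · exact ⟨0, fun k hk => (hx ⟨k, hk⟩).elim⟩
  have hcont : ∀ f, Continuous fun x => (h (κ x) * inner C(X, ℂ) (g (κ x)) f) x := fun f =>
    continuous_apply_of_tendsto_norm (a := fun k => h k * inner C(X, ℂ) (g k) f)
      (fun k x hk => hκ x k (left_ne_zero_of_mul hk)) (ht f)
  refine ⟨{ toFun := fun f => ⟨_, hcont f⟩, map_add' := fun f f' => ?_, map_smul' := fun ξ f => ?_ },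
    ⟨B, fun f => ?_⟩, fun f k x hk => ?_⟩
  · ext x
    simp [mul_add]
  · ext x
    simp [mul_left_comm]
  · have hf := CStarModule.norm_nonneg C(X, ℂ) (x := f)
    have hB0 : 0 ≤ B := (CStarModule.norm_nonneg C(X, ℂ)).trans (hB 0)
    refine (ContinuousMap.norm_le _ (by positivity)).mpr fun x => ?_
    calc ‖h (κ x) x * inner C(X, ℂ) (g (κ x)) f x‖
        = ‖h (κ x) x‖ * ‖inner C(X, ℂ) (g (κ x)) f x‖ := norm_mul _ _
      _ ≤ ‖inner C(X, ℂ) (g (κ x)) f x‖ := mul_le_of_le_one_left (norm_nonneg _) (h1 _ _)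
      _ ≤ ‖inner C(X, ℂ) (g (κ x)) f‖ := ContinuousMap.norm_coe_le_norm _ _
      _ ≤ ‖g (κ x)‖ * ‖f‖ := CStarModule.norm_inner_le _
      _ ≤ B * ‖f‖ := by gcongr; exact hB _
  · obtain rfl := hκ x k hk
    rfl

theorem IsSelfDualCStarModule.tendsto_norm_inner_self
    (hM : IsSelfDualCStarModule C(X, ℂ) M) {h : ℕ → C(X, ℂ)} {g : ℕ → M} {u : ℕ → X} {B : ℝ}
    (hdisj : ∀ i j, i ≠ j → ∀ x, h i x = 0 ∨ h j x = 0) (h1 : ∀ k x, ‖h k x‖ ≤ 1)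
    (hu : ∀ k, h k (u k) = 1) (hB : ∀ k, ‖g k‖ ≤ B)
    (ht : ∀ f, Tendsto (fun k => ‖h k * inner C(X, ℂ) (g k) f‖) atTop (𝓝 0)) :
    Tendsto (fun k => ‖inner C(X, ℂ) (g k) (g k) (u k)‖) atTop (𝓝 0) := by
  obtain ⟨φ, hφ, hφ'⟩ := exists_linearMap_of_disjoint hdisj h1 hB ht
  obtain ⟨g', hg', -⟩ := hM φ hφ
  refine squeeze_zero (fun _ => norm_nonneg _) (fun k => ?_) (ht g')
  have hk : ∀ f, inner C(X, ℂ) g' f (u k) = inner C(X, ℂ) (g k) f (u k) := fun f => by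
    simpa [hu, hg'] using hφ' f k (u k) (by simp [hu])
  calc ‖inner C(X, ℂ) (g k) (g k) (u k)‖ = ‖inner C(X, ℂ) g' (g k) (u k)‖ := by rw [hk]
    _ = ‖inner C(X, ℂ) (g k) g' (u k)‖ := by
      rw [← CStarModule.star_inner (g k) g']
      exact norm_star _
    _ = ‖(h k * inner C(X, ℂ) (g k) g') (u k)‖ := by simp [hu]
    _ ≤ ‖h k * inner C(X, ℂ) (g k) g'‖ := ContinuousMap.norm_coe_le_norm _ _

end SelfDual

namespace PullbackModule

variable {X Y : Type*} [TopologicalSpace X] [TopologicalSpace Y]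
    {p : C(Y, X)}

theorem toContinuousMap_sub (f g : PullbackModule p) :
    (f - g).toContinuousMap = f.toContinuousMap - g.toContinuousMap := rfl

theorem toContinuousMap_sum {ι : Type*} (s : Finset ι) (f : ι → PullbackModule p) :
    (∑ i ∈ s, f i).toContinuousMap = ∑ i ∈ s, (f i).toContinuousMap :=
  map_sum (⟨⟨toContinuousMap, rfl⟩, fun _ _ => rfl⟩ : PullbackModule p →+ C(Y, ℂ)) f s

variable [CompactSpace X] [CompactSpace Y] [T2Space Y]
    [Norm (PullbackModule p)] [CStarModule C(X, ℂ) (PullbackModule p)] {c K : ℝ}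

theorem exists_inner_eq_zero (F : Finset Y) (e : Y → PullbackModule p) (x : X)
    (hx : (F.card : ℕ∞) < (p ⁻¹' {x}).encard) :
    ∃ g : PullbackModule p, ‖g.toContinuousMap‖ ≤ F.card + 1 ∧
      (∃ y, p y = x ∧ ‖g.toContinuousMap y‖ = 1) ∧ ∀ z ∈ F, inner C(X, ℂ) g (e z) x = 0 := by
  obtain ⟨T, hT, hTcard⟩ : ∃ T : Finset Y, (T : Set Y) ⊆ p ⁻¹' {x} ∧ T.card = F.card + 1 := by
    obtain ⟨t, ht, ht'⟩ := Set.exists_subset_encard_eq (Order.add_one_le_of_lt hx)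
    have htf : t.Finite := Set.finite_of_encard_eq_coe (k := F.card + 1) (by simpa using ht')
    refine ⟨htf.toFinset, by simpa using ht, ?_⟩
    rw [htf.encard_eq_coe_toFinset_card] at ht'
    exact_mod_cast ht'
  obtain ⟨b, hb1, hb2, hb3⟩ := exists_disjoint_bumps T.finite_toSet
  let L : (T → ℂ) →ₗ[ℂ] (F → ℂ) := LinearMap.pi fun z =>
    ∑ j : T, inner C(X, ℂ) (e z) (⟨b j⟩ : PullbackModule p) x • LinearMap.proj j
  have hL : LinearMap.ker L ≠ ⊥ := LinearMap.ker_ne_bot_of_finrank_lt (by simp [hTcard])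
  obtain ⟨a, haL, ha0⟩ := (Submodule.ne_bot_iff _).mp hL
  have : Nonempty T := by
    rw [← Fintype.card_pos_iff]; simp [hTcard]
  obtain ⟨m, hm⟩ := Finite.exists_max fun j => ‖a j‖
  have ham : a m ≠ 0 := fun h => ha0 <| funext fun j => by simpa [h] using hm j
  let a' : T → ℂ := (a m)⁻¹ • a
  have ha'L : L a' = 0 := by rw [map_smul, LinearMap.mem_ker.mp haL, smul_zero]
  have ha'1 : ∀ j, ‖a' j‖ ≤ 1 := fun j => by
    simp only [a', Pi.smul_apply, smul_eq_mul, norm_mul, norm_inv]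
    exact inv_mul_le_one_of_le₀ (hm j) (norm_nonneg _)
  have ha'm : a' m = 1 := by simp [a', ham]
  have happ : ∀ y, (∑ j : T, a' j • (⟨b j⟩ : PullbackModule p)).toContinuousMap y =
      ∑ j : T, a' j * b j y := fun y => by simp [toContinuousMap_sum, ContinuousMap.sum_apply]
  refine ⟨∑ j : T, a' j • ⟨b j⟩, ?_, ⟨m, hT m.2, ?_⟩, fun z hz => ?_⟩
  · refine (ContinuousMap.norm_le _ (by positivity)).mpr fun y => ?_
    rw [happ]
    refine (norm_sum_le_of_le (n := fun _ => 1) _ fun j _ => ?_).trans (by simp [hTcard])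
    rw [norm_mul]
    exact mul_le_one₀ (ha'1 j) (norm_nonneg _) (hb2 j j.2 y)
  · rw [happ, Finset.sum_eq_single_of_mem m (Finset.mem_univ _), ha'm, hb1 m m.2]
    · simp
    · intro j _ hj
      rw [(hb3 j j.2 m m.2 (fun h => hj (Subtype.ext h)) m).resolve_right (by simp [hb1 m m.2]),
        mul_zero]
  · rw [← CStarModule.star_inner, ContinuousMap.star_apply, star_eq_zero]
    have := congrFun ha'L ⟨z, hz⟩
    simpa [L, LinearMap.pi_apply, ContinuousMap.sum_apply, mul_comm] using this

theorem eventually_encard_fiber_le [T2Space X] [SecondCountableTopology X]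
    (hc : 0 < c) (hK : 0 < K)
    (hcK : ∀ f : PullbackModule p, c * ‖f.toContinuousMap‖ ≤ ‖f‖ ∧
      ‖f‖ ≤ K * ‖f.toContinuousMap‖)
    (hsd : IsSelfDualCStarModule C(X, ℂ) (PullbackModule p)) (x₀ : X) :
    ∀ᶠ x in 𝓝 x₀, (p ⁻¹' {x}).encard ≤ (p ⁻¹' {x₀}).encard := by
  let _ := TopologicalSpace.metrizableSpaceMetric X
  have hfin := finite_fiber_of_norm_le hc hK hcK x₀
  obtain ⟨F, hF⟩ := hfin.exists_finset_coe
  by_contra hbad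
  obtain ⟨e, he1, he2, he3⟩ := exists_disjoint_bumps hfin
  have hN : (p ⁻¹' {x₀}).encard = F.card := by rw [← hF, Set.encard_coe_eq_coe_finsetCard]
  have hex : ∀ r > 0, ∃ x, (F.card : ℕ∞) < (p ⁻¹' {x}).encard ∧ dist x x₀ < r := fun r hr => by
    rw [hN, not_eventually] at hbad
    obtain ⟨x, hx, hx'⟩ := (hbad.and_eventually (Metric.ball_mem_nhds x₀ hr)).exists
    exact ⟨x, not_le.mp hx, hx'⟩
  have hpos : ∀ x, (F.card : ℕ∞) < (p ⁻¹' {x}).encard → 0 < dist x x₀ := fun x hx => by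
    rw [dist_pos]
    rintro rfl
    exact hx.ne' hN
  have : Nonempty X := ⟨x₀⟩
  choose! next hnext1 hnext2 using hex
  let u : ℕ → X := fun k => Nat.rec (next 1) (fun _ x => next (dist x x₀ / 2)) k
  have hu : ∀ k, (F.card : ℕ∞) < (p ⁻¹' {u k}).encard := fun k => by
    induction k with
    | zero => exact hnext1 1 one_pos
    | succ k ih => exact hnext1 _ (half_pos (hpos _ ih))
  have hr : ∀ k, dist (u (k + 1)) x₀ < dist (u k) x₀ / 2 := fun k =>
    hnext2 _ (half_pos (hpos _ (hu k)))
  have hanti : Antitone fun k => dist (u k) x₀ := antitone_nat_of_succ_le fun k => by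
    linarith [hr k, hpos _ (hu k)]
  have hrt : Tendsto (fun k => dist (u k) x₀) atTop (𝓝 0) := by
    have hle : ∀ k, dist (u k) x₀ ≤ (1 / 2) ^ k * dist (u 0) x₀ := fun k => by
      induction k with
      | zero => simp
      | succ k ih => rw [pow_succ]; linarith [hr k]
    refine squeeze_zero (fun _ => dist_nonneg) hle ?_
    simpa using (tendsto_pow_atTop_nhds_zero_of_lt_one (r := (1 / 2 : ℝ)) (by norm_num)
      (by norm_num)).mul_const (dist (u 0) x₀)
  choose g hg1 hg2 hg3 using fun k => exists_inner_eq_zero F (fun z => ⟨e z⟩) (u k) (hu k)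
  let V : ℕ → Set X := fun k => {x | dist x (u k) < dist (u k) x₀ / 4 ∧
    ∀ z ∈ F, ‖inner C(X, ℂ) (g k) (⟨e z⟩ : PullbackModule p) x‖ < 1 / ((k : ℝ) + 1)}
  have hV : ∀ k, V k ∈ 𝓝 (u k) := fun k => by
    refine inter_mem (Metric.ball_mem_nhds (u k) (by linarith [hpos _ (hu k)])) ?_
    refine (Finset.eventually_all F).mpr fun z hz => ?_
    refine (isOpen_lt (by fun_prop) continuous_const).mem_nhds ?_
    change ‖_‖ < _
    rw [hg3 k z hz, norm_zero]
    positivity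
  choose h hh1 hh2 hh3 using fun k => exists_bump (hV k)
  have hdist : ∀ k, ∀ x ∈ V k, 3 / 4 * dist (u k) x₀ < dist x x₀ ∧
      dist x x₀ < 5 / 4 * dist (u k) x₀ := fun k x hx => by
    constructor <;> linarith [hx.1, dist_triangle_left (u k) x₀ x, dist_triangle x (u k) x₀]
  have hdisj' : ∀ i j, i < j → ∀ x, h i x = 0 ∨ h j x = 0 := fun i j hij x => by
    by_contra! hx
    have hi := (hdist i x (by_contra fun hxi => hx.1 (hh3 i x hxi))).1
    have hj := (hdist j x (by_contra fun hxj => hx.2 (hh3 j x hxj))).2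
    have : dist (u j) x₀ ≤ dist (u (i + 1)) x₀ := hanti hij
    linarith [hr i, hpos _ (hu i)]
  have hdisj : ∀ i j, i ≠ j → ∀ x, h i x = 0 ∨ h j x = 0 := fun i j hij x =>
    hij.lt_or_gt.elim (fun hlt => hdisj' i j hlt x) fun hlt => (hdisj' j i hlt x).symm
  have hB : ∀ k, ‖g k‖ ≤ K * (F.card + 1) := fun k => (hcK _).2.trans (by gcongr; exact hg1 k)
  have hlim : ∀ f, Tendsto (fun k => ‖h k * inner C(X, ℂ) (g k) f‖) atTop (𝓝 0) := fun f => by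
    let r : PullbackModule p := f - ∑ z ∈ F, f.toContinuousMap z • ⟨e z⟩
    have hr0 : ∀ y, p y = x₀ → r.toContinuousMap y = 0 := fun y hy => by
      have hyF : y ∈ F := by rw [← Finset.mem_coe, hF]; exact hy
      have hsum : (∑ z ∈ F, f.toContinuousMap z • (⟨e z⟩ : PullbackModule p)).toContinuousMap y =
          f.toContinuousMap y := by
        rw [toContinuousMap_sum, ContinuousMap.sum_apply, Finset.sum_eq_single_of_mem y hyF]
        · simp [he1 y hy]
        · intro z hz hzy
          have hz' : z ∈ p ⁻¹' {x₀} := hF ▸ Finset.mem_coe.mpr hz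
          simp [(he3 z hz' y hy hzy y).resolve_right (by simp [he1 y hy])]
      rw [toContinuousMap_sub, ContinuousMap.sub_apply, hsum, sub_self]
    obtain ⟨C, hC⟩ : ∃ C : ℝ, C = K * (F.card + 1) * K + 1 := ⟨_, rfl⟩
    have hC0 : 0 < C := by rw [hC]; positivity
    have key : ∀ ε > 0, ∀ᶠ k in atTop, ‖h k * inner C(X, ℂ) (g k) f‖ ≤ C * ε := fun ε hε => by
      have hW : ∀ᶠ x in 𝓝 x₀, ∀ y, p y = x → ‖r.toContinuousMap y‖ < ε :=
        p.continuous.isClosedMap.eventually_nhds_fiber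
          (p := fun y => ‖r.toContinuousMap y‖ < ε) x₀ fun y hy =>
          (isOpen_lt (by fun_prop) continuous_const).mem_nhds (by
            change ‖_‖ < _
            rwa [hr0 y hy, norm_zero])
      obtain ⟨δ, hδ, hδW⟩ := Metric.eventually_nhds_iff.mp hW
      have ht1 := hrt.eventually_lt_const (mul_pos (by norm_num : (0 : ℝ) < 4 / 5) hδ)
      have ht2 : Tendsto (fun k : ℕ => (∑ z ∈ F, ‖f.toContinuousMap z‖) * (1 / ((k : ℝ) + 1)))
          atTop (𝓝 0) := by
        simpa using tendsto_one_div_add_atTop_nhds_zero_nat.const_mul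
          (∑ z ∈ F, ‖f.toContinuousMap z‖)
      filter_upwards [ht1, ht2.eventually_lt_const hε] with k hk1 hk2
      refine (ContinuousMap.norm_le _ (by positivity)).mpr fun x => ?_
      rw [ContinuousMap.mul_apply, norm_mul]
      by_cases hx : x ∈ V k
      · refine (mul_le_of_le_one_left (norm_nonneg _) (hh2 k x)).trans ?_
        have hrx := norm_inner_apply_le hK (fun f => (hcK f).2) (g k) r (x := x) hε.le
          fun y hy => (hδW (by linarith [(hdist k x hx).2]) y hy).le
        have hsx : ‖∑ z ∈ F, f.toContinuousMap z * inner C(X, ℂ) (g k) (⟨e z⟩ : PullbackModule p) x‖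
            ≤ (∑ z ∈ F, ‖f.toContinuousMap z‖) * (1 / ((k : ℝ) + 1)) := by
          rw [Finset.sum_mul]
          refine norm_sum_le_of_le _ fun z hz => ?_
          rw [norm_mul]
          exact mul_le_mul_of_nonneg_left (hx.2 z hz).le (norm_nonneg _)
        have hfx : inner C(X, ℂ) (g k) f x = inner C(X, ℂ) (g k) r x +
            ∑ z ∈ F, f.toContinuousMap z * inner C(X, ℂ) (g k) (⟨e z⟩ : PullbackModule p) x := by
          have hsplit : inner C(X, ℂ) (g k) f = inner C(X, ℂ) (g k) r +
              inner C(X, ℂ) (g k) (∑ z ∈ F, f.toContinuousMap z • (⟨e z⟩ : PullbackModule p)) := by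
            rw [← CStarModule.inner_add_right, sub_add_cancel]
          rw [hsplit]
          simp [ContinuousMap.sum_apply]
        have hgk : ‖g k‖ * (K * ε) ≤ K * (F.card + 1) * (K * ε) := by gcongr; exact hB k
        rw [hfx]
        refine (norm_add_le _ _).trans ?_
        rw [hC]
        linarith
      · rw [hh3 k x hx, norm_zero, zero_mul]
        positivity
    rw [Metric.tendsto_atTop]
    intro ε hε
    obtain ⟨n, hn⟩ := eventually_atTop.mp (key (ε / (2 * C)) (by positivity))
    refine ⟨n, fun k hk => ?_⟩
    rw [dist_zero_right, norm_norm]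
    refine (hn k hk).trans_lt ?_
    field_simp
    linarith
  have ht := hsd.tendsto_norm_inner_self hdisj hh2 hh1 hB hlim
  have hge : ∀ k, c ^ 2 ≤ ‖inner C(X, ℂ) (g k) (g k) (u k)‖ := fun k => by
    obtain ⟨y, hy, hy1⟩ := hg2 k
    simpa [hy, hy1] using sq_mul_le_norm_inner_self hc (fun f => (hcK f).1) (g k) y
  exact (pow_pos hc 2).not_ge (ge_of_tendsto' ht hge)

end PullbackModule

section FiniteFold

variable {X Y : Type*} [TopologicalSpace X] [TopologicalSpace Y]

theorem eventually_subsingleton_inter_fiber [T2Space Y] {p : Y → X} (hopen : IsOpenMap p) (x₀ : X)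
    (hfin : (p ⁻¹' {x₀}).Finite)
    (hle : ∀ᶠ x in 𝓝 x₀, (p ⁻¹' {x}).encard ≤ (p ⁻¹' {x₀}).encard) :
    ∃ W : Y → Set Y, (∀ y, y ∈ W y ∧ IsOpen (W y)) ∧ ∀ᶠ x in 𝓝 x₀,
      (p ⁻¹' {x}).encard = (p ⁻¹' {x₀}).encard ∧
        ∀ y ∈ p ⁻¹' {x₀}, (W y ∩ p ⁻¹' {x}).Subsingleton := by
  obtain ⟨W, hW, hd⟩ := hfin.t2_separation
  refine ⟨W, hW, ?_⟩
  have hmeet : ∀ᶠ x in 𝓝 x₀, ∀ y ∈ p ⁻¹' {x₀}, ∃ w ∈ W y, p w = x := by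
    refine (eventually_all_finite hfin).mpr fun y hy => ?_
    have := hopen.image_mem_nhds ((hW y).2.mem_nhds (hW y).1)
    rwa [show p y = x₀ from hy] at this
  filter_upwards [hle, hmeet] with x hx hmx
  choose! w hw hpw using hmx
  have hinj : Set.InjOn w (p ⁻¹' {x₀}) := fun y hy y' hy' hyy' => by
    by_contra hne
    exact (hd hy hy' hne).le_bot ⟨hw y hy, hyy' ▸ hw y' hy'⟩
  have hsub : w '' (p ⁻¹' {x₀}) ⊆ p ⁻¹' {x} := Set.image_subset_iff.mpr fun y hy => hpw y hy
  have heq : w '' (p ⁻¹' {x₀}) = p ⁻¹' {x} :=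
    (hfin.image w).eq_of_subset_of_encard_le hsub (by rwa [hinj.encard_image])
  refine ⟨by rw [← heq, hinj.encard_image], fun y hy => ?_⟩
  have huniq : ∀ v ∈ W y ∩ p ⁻¹' {x}, v = w y := by
    rintro v ⟨hv, hvx⟩
    rw [← heq] at hvx
    obtain ⟨y', hy', rfl⟩ := hvx
    by_contra hne
    exact (hd hy hy' fun h => hne (h ▸ rfl)).le_bot ⟨hv, hw y' hy'⟩
  exact fun v hv v' hv' => (huniq v hv).trans (huniq v' hv').symm

theorem isFiniteFoldCovering_of_encard_fiber_le [CompactSpace Y] [T2Space Y] [T2Space X]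
    [ConnectedSpace X] {p : Y → X} (hp : Continuous p) (hopen : IsOpenMap p)
    (hfin : ∀ x, (p ⁻¹' {x}).Finite)
    (hle : ∀ x₀, ∀ᶠ x in 𝓝 x₀, (p ⁻¹' {x}).encard ≤ (p ⁻¹' {x₀}).encard) :
    IsFiniteFoldCovering p := by
  refine ⟨?_, ?_⟩
  · rw [← isLocalHomeomorph_iff_isCoveringMap,
      isLocalHomeomorph_iff_isOpenEmbedding_restrict]
    intro y
    obtain ⟨W, hW, hev⟩ := eventually_subsingleton_inter_fiber hopen (p y) (hfin _) (hle _)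
    obtain ⟨O, hO, hOo, hyO⟩ := eventually_nhds_iff.mp hev
    have hU : IsOpen (W y ∩ p ⁻¹' O) := (hW y).2.inter (hOo.preimage hp)
    refine ⟨W y ∩ p ⁻¹' O, hU.mem_nhds ⟨(hW y).1, hyO⟩,
      .of_continuous_injective_isOpenMap (hp.comp continuous_subtype_val) ?_
        (hopen.comp hU.isOpenMap_subtype_val)⟩
    rintro ⟨v, hv, hvO⟩ ⟨v', hv', hvO'⟩ h
    exact Subtype.ext ((hO _ hvO).2 y rfl ⟨hv, rfl⟩ ⟨hv', h.symm⟩)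
  · have hconst : IsLocallyConstant fun x => (p ⁻¹' {x}).encard := by
      refine (IsLocallyConstant.iff_eventually_eq _).mpr fun x₀ => ?_
      obtain ⟨W, -, hev⟩ := eventually_subsingleton_inter_fiber hopen x₀ (hfin _) (hle _)
      exact hev.mono fun x hx => hx.1
    obtain ⟨x₀⟩ := (inferInstance : Nonempty X)
    refine ⟨(hfin x₀).toFinset.card, fun x => ?_⟩
    rw [← (hfin x₀).encard_eq_coe_toFinset_card]
    exact hconst.apply_eq_of_preconnectedSpace x x₀

theorem IsCoveringMap.continuous_sum_fiber {p : Y → X} (hp : IsCoveringMap p)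
    (hfin : ∀ x, (p ⁻¹' {x}).Finite) {f : Y → ℂ} (hf : Continuous f) :
    Continuous fun x => ∑ y ∈ (hfin x).toFinset, f y := by
  refine continuous_iff_continuousAt.mpr fun x₀ => ?_
  obtain ⟨-, U, hxU, hU, -, H, hH⟩ := hp x₀
  have : Fintype (p ⁻¹' {x₀}) := (hfin x₀).fintype
  have hsum : ∀ x : U, ∑ y ∈ (hfin x).toFinset, f y = ∑ i, f (H.symm (x, i)) := by
    intro x
    refine (Finset.sum_bij (fun i _ => (H.symm (x, i) : Y)) ?_ ?_ ?_ ?_).symm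
    · intro i _
      simp [← hH]
    · intro i _ j _ hij
      simpa using H.symm.injective (Subtype.ext hij)
    · intro y hy
      have hy' : p y = x := by simpa using hy
      have hyU : y ∈ p ⁻¹' U := by simp [hy']
      refine ⟨(H ⟨y, hyU⟩).2, Finset.mem_univ _, ?_⟩
      have : (x, (H ⟨y, hyU⟩).2) = H ⟨y, hyU⟩ :=
        Prod.ext (Subtype.ext (by rw [hH]; exact hy'.symm)) rfl
      rw [this, H.symm_apply_apply]
    · intros; rfl
  have hcont : ContinuousOn (fun x => ∑ y ∈ (hfin x).toFinset, f y) U := by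
    rw [continuousOn_iff_continuous_domRestrict]
    have : U.domRestrict (fun x => ∑ y ∈ (hfin x).toFinset, f y) =
        fun x : U => ∑ i, f (H.symm (x, i)) := funext hsum
    rw [this]
    fun_prop
  exact hcont.continuousAt (hU.mem_nhds hxU)

theorem IsLocalHomeomorph.exists_frame [CompactSpace Y] [T2Space Y] {p : Y → X}
    (hp : IsLocalHomeomorph p) [DecidableEq Y] :
    ∃ (t : Finset Y) (g : Y → C(Y, ℂ)), ∀ y y', p y = p y' →
      ∑ i ∈ t, g i y * star (g i y') = if y = y' then 1 else 0 := by
  have hinj : ∀ y, ∃ U ∈ 𝓝 y, Set.InjOn p U := fun y => by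
    obtain ⟨e, hy, rfl⟩ := hp y
    exact ⟨e.source, e.open_source.mem_nhds hy, e.injOn⟩
  choose U hU hUinj using hinj
  choose b hb1 hb2 hb3 using fun y => exists_bump (hU y)
  obtain ⟨t, ht⟩ := CompactSpace.elim_nhds_subcover (fun y => {w | b y w ≠ 0}) fun y =>
    (isOpen_ne_fun (b y).continuous continuous_const).mem_nhds (by simp [hb1])
  let S : Y → ℝ := fun w => ∑ i ∈ t, ‖b i w‖ ^ 2
  have hS : ∀ w, 0 < S w := fun w => by
    obtain ⟨i, hi, hw⟩ : ∃ i ∈ t, b i w ≠ 0 := by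
      simpa using (ht ▸ Set.mem_univ w : w ∈ ⋃ y ∈ t, {w | b y w ≠ 0})
    exact Finset.sum_pos' (fun _ _ => by positivity) ⟨i, hi, by positivity⟩
  have hSc : Continuous S := by fun_prop
  have hSqrt : ∀ w, Real.sqrt (S w) ≠ 0 := fun w => (Real.sqrt_pos.mpr (hS w)).ne'
  refine ⟨t, fun i => ⟨fun w => b i w * ((Real.sqrt (S w))⁻¹ : ℝ), ?_⟩, fun y y' hyy' => ?_⟩
  · have : Continuous fun w => (Real.sqrt (S w))⁻¹ := (hSc.sqrt).inv₀ hSqrt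
    fun_prop
  · split_ifs with h
    · subst h
      have hterm : ∀ i, b i y * ((Real.sqrt (S y))⁻¹ : ℝ) * star (b i y * ((Real.sqrt (S y))⁻¹ : ℝ))
          = ((‖b i y‖ ^ 2 * (S y)⁻¹ : ℝ) : ℂ) := fun i => by
        have h1 : ((Real.sqrt (S y))⁻¹) ^ 2 = (S y)⁻¹ := by rw [inv_pow, Real.sq_sqrt (hS y).le]
        rw [← starRingEnd_apply, Complex.mul_conj', norm_mul, Complex.norm_real, Real.norm_eq_abs,
          ← Complex.ofReal_pow, mul_pow, sq_abs, h1]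
      simp only [ContinuousMap.coe_mk, hterm]
      rw [← Complex.ofReal_sum, ← Finset.sum_mul, mul_inv_cancel₀ (hS y).ne', Complex.ofReal_one]
    · refine Finset.sum_eq_zero fun i _ => ?_
      by_cases hy : y ∈ U i
      · have hy' : y' ∉ U i := fun hy' => h (hUinj i hy hy' hyy')
        simp [hb3 i y' hy']
      · simp [hb3 i y hy]

end FiniteFold

namespace PullbackModule

variable {X Y : Type*} [TopologicalSpace X] [TopologicalSpace Y] {p : C(Y, X)}

/-- The inner product `⟪f, g⟫ x = ∑ conj (f y) * g y`, the sum being over the fibre of `x`. -/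
noncomputable def fiberInner (hp : IsCoveringMap p) (hfin : ∀ x, (p ⁻¹' {x}).Finite)
    (f g : PullbackModule p) : C(X, ℂ) where
  toFun x := ∑ y ∈ (hfin x).toFinset, star (f.toContinuousMap y) * g.toContinuousMap y
  continuous_toFun := hp.continuous_sum_fiber hfin
    (f := fun y => star (f.toContinuousMap y) * g.toContinuousMap y) (by fun_prop)

theorem fiberInner_apply (hp : IsCoveringMap p) (hfin : ∀ x, (p ⁻¹' {x}).Finite)
    (f g : PullbackModule p) (x : X) : fiberInner hp hfin f g x =
      ∑ y ∈ (hfin x).toFinset, star (f.toContinuousMap y) * g.toContinuousMap y := rfl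

theorem fiberInner_self_apply (hp : IsCoveringMap p) (hfin : ∀ x, (p ⁻¹' {x}).Finite)
    (f : PullbackModule p) (x : X) : fiberInner hp hfin f f x =
      ((∑ y ∈ (hfin x).toFinset, ‖f.toContinuousMap y‖ ^ 2 : ℝ) : ℂ) := by
  rw [fiberInner_apply, Complex.ofReal_sum]
  refine Finset.sum_congr rfl fun y _ => ?_
  rw [← starRingEnd_apply, Complex.conj_mul']
  push_cast
  rfl

theorem sq_norm_le_norm_fiberInner_self (hp : IsCoveringMap p) (hfin : ∀ x, (p ⁻¹' {x}).Finite)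
    (f : PullbackModule p) (y : Y) :
    ‖f.toContinuousMap y‖ ^ 2 ≤ ‖fiberInner hp hfin f f (p y)‖ := by
  rw [fiberInner_self_apply, Complex.norm_real, Real.norm_of_nonneg (by positivity)]
  exact Finset.single_le_sum (f := fun y => ‖f.toContinuousMap y‖ ^ 2)
    (fun _ _ => by positivity) (by simp)

variable [CompactSpace X]

/-- The norm given by the inner product `fiberInner`. -/
@[reducible]
noncomputable def fiberNorm (hp : IsCoveringMap p) (hfin : ∀ x, (p ⁻¹' {x}).Finite) :
    Norm (PullbackModule p) := ⟨fun f => √‖fiberInner hp hfin f f‖⟩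

/-- The Hilbert module structure given by the inner product `fiberInner`. -/
@[reducible]
noncomputable def fiberCStarModule (hp : IsCoveringMap p) (hfin : ∀ x, (p ⁻¹' {x}).Finite) :
    letI := fiberNorm hp hfin
    CStarModule C(X, ℂ) (PullbackModule p) :=
  letI := fiberNorm hp hfin
  { inner := fiberInner hp hfin
    inner_add_right := by
      intros; ext x
      simp [fiberInner_apply, mul_add, Finset.sum_add_distrib]
    inner_self_nonneg := by
      intro f x
      change 0 ≤ fiberInner hp hfin f f x
      rw [fiberInner_self_apply, Complex.zero_le_real]
      positivity
    inner_self := by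
      refine fun {f} => ⟨fun h => ?_, ?_⟩
      · ext y
        have := sq_norm_le_norm_fiberInner_self hp hfin f y
        rw [h] at this
        simpa using this
      · rintro rfl
        ext x
        simp [fiberInner_apply]
    inner_op_smul_right := by
      intro a f g; ext x
      simp only [fiberInner_apply, ContinuousMap.mul_apply, Finset.mul_sum, toContinuousMap_smul,
        ContinuousMap.comp_apply]
      refine Finset.sum_congr rfl fun y hy => ?_
      rw [show p y = x by simpa using hy]
      ring
    inner_smul_right_complex := by
      intro z f g; ext x
      simp [fiberInner_apply, Finset.mul_sum, mul_left_comm]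
    star_inner := by
      intro f g; ext x
      simp [fiberInner_apply, mul_comm]
    norm_eq_sqrt_norm_inner_self := fun _ => rfl }

theorem isSelfDual_fiberCStarModule [CompactSpace Y] [T2Space Y] (hp : IsCoveringMap p)
    (hfin : ∀ x, (p ⁻¹' {x}).Finite) :
    letI := fiberNorm hp hfin
    letI := fiberCStarModule hp hfin
    IsSelfDualCStarModule C(X, ℂ) (PullbackModule p) := by
  let _ := fiberNorm hp hfin
  let _ := fiberCStarModule hp hfin
  classical
  obtain ⟨t, g, hg⟩ := hp.isLocalHomeomorph.exists_frame
  have hexp : ∀ f : PullbackModule p,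
      f = ∑ i ∈ t, inner C(X, ℂ) (⟨g i⟩ : PullbackModule p) f • ⟨g i⟩ := by
    intro f
    ext y
    have hin : ∀ i, inner C(X, ℂ) (⟨g i⟩ : PullbackModule p) f (p y) =
        ∑ y' ∈ (hfin (p y)).toFinset, star (g i y') * f.toContinuousMap y' := fun i => rfl
    rw [toContinuousMap_sum, ContinuousMap.sum_apply]
    simp only [toContinuousMap_smul, ContinuousMap.mul_apply, ContinuousMap.comp_apply, hin,
      Finset.sum_mul]
    rw [Finset.sum_comm]
    have hy' : ∀ y' ∈ (hfin (p y)).toFinset,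
        ∑ i ∈ t, star (g i y') * f.toContinuousMap y' * g i y =
          if y = y' then f.toContinuousMap y' else 0 := fun y' hy' => by
      have := hg y y' (by simpa [eq_comm] using hy')
      rw [← one_mul (f.toContinuousMap y'), ← zero_mul (f.toContinuousMap y'), ← ite_mul, ← this,
        Finset.sum_mul]
      exact Finset.sum_congr rfl fun i _ => by ring
    rw [Finset.sum_congr rfl hy', Finset.sum_ite_eq, if_pos (by simp)]
  intro φ _
  have hrep : ∀ f, φ f = inner C(X, ℂ) (∑ i ∈ t, star (φ ⟨g i⟩) • (⟨g i⟩ : PullbackModule p)) f :=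
    fun f => by
      conv_lhs => rw [hexp f]
      simp
  refine ⟨_, hrep, fun f hf => sub_eq_zero.mp ?_⟩
  rw [← CStarModule.inner_self (A := C(X, ℂ)), CStarModule.inner_sub_left, ← hf, ← hrep, sub_self]

theorem isSelfDualPullback_of_isFiniteFoldCovering [CompactSpace Y] [T2Space Y]
    (hp : IsFiniteFoldCovering p) : IsSelfDualPullback p := by
  obtain ⟨hcov, n, hn⟩ := hp
  have hfin : ∀ x, (p ⁻¹' {x}).Finite := fun x => Set.finite_of_encard_eq_coe (hn x)
  have hcard : ∀ x, (hfin x).toFinset.card = n := fun x => by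
    have := hn x
    rw [(hfin x).encard_eq_coe_toFinset_card] at this
    exact_mod_cast this
  refine ⟨fiberNorm hcov hfin, fiberCStarModule hcov hfin, ⟨1, √(n + 1), one_pos, by positivity,
    fun f => ⟨?_, ?_⟩⟩, isSelfDual_fiberCStarModule hcov hfin⟩
  · rw [one_mul]
    refine (ContinuousMap.norm_le _ (Real.sqrt_nonneg _)).mpr fun y => Real.le_sqrt_of_sq_le ?_
    exact (sq_norm_le_norm_fiberInner_self hcov hfin f y).trans (ContinuousMap.norm_coe_le_norm _ _)
  · refine (Real.sqrt_le_left (by positivity)).mpr ?_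
    rw [mul_pow, Real.sq_sqrt (by positivity)]
    refine (ContinuousMap.norm_le _ (by positivity)).mpr fun x => ?_
    rw [fiberInner_self_apply, Complex.norm_real, Real.norm_of_nonneg (by positivity)]
    calc ∑ y ∈ (hfin x).toFinset, ‖f.toContinuousMap y‖ ^ 2
        ≤ (hfin x).toFinset.card • ‖f.toContinuousMap‖ ^ 2 := Finset.sum_le_card_nsmul _ _ _
          fun y _ => pow_le_pow_left₀ (norm_nonneg _) (f.toContinuousMap.norm_coe_le_norm y) 2
      _ ≤ (n + 1) * ‖f.toContinuousMap‖ ^ 2 := by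
        rw [hcard, nsmul_eq_mul]
        gcongr
        linarith

theorem IsSelfDualPullback.isFiniteFoldCovering [CompactSpace Y] [T2Space X] [T2Space Y]
    [ConnectedSpace X] [SecondCountableTopology Y] (hsd : IsSelfDualPullback p)
    (hp : Function.Surjective p) : IsFiniteFoldCovering p := by
  obtain ⟨_, _, ⟨c, K, hc, hK, hcK⟩, hsd⟩ := hsd
  have hopen := isOpenMap_of_norm_le hc hK hcK
  have : SecondCountableTopology X :=
    (p.continuous.isClosedMap.isQuotientMap p.continuous hp).secondCountableTopology hopen
  exact isFiniteFoldCovering_of_encard_fiber_le p.continuous hopen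
    (finite_fiber_of_norm_le hc hK hcK) (eventually_encard_fiber_le hc hK hcK hsd)

end PullbackModule

theorem mainTheorem4 {X Y : Type*} [TopologicalSpace X] [TopologicalSpace Y]
    [CompactSpace X] [T2Space X] [CompactSpace Y] [T2Space Y]
    [ConnectedSpace X] [SecondCountableTopology Y]
    (p : C(Y, X)) (hp : Function.Surjective p) :
    IsSelfDualPullback p ↔ IsFiniteFoldCovering p :=
  ⟨fun h => PullbackModule.IsSelfDualPullback.isFiniteFoldCovering h hp,
    PullbackModule.isSelfDualPullback_of_isFiniteFoldCovering⟩
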